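/- Let $W(\mathbb{R},\mathbb{C})$ be the set of all functions $F:\mathbb{R}\to\mathbb{C}$ for which there are $p\in\mathbb{C}$ and $f\in L^1(\mathbb{R},\mathbb{C})$ with $F(z)=p+\int_{\mathbb{R}} f(x)e^{ixz}\,dx$ for all $z\in\mathbb{R}$. Such an $F$ extends continuously to $\overline{\mathbb{R}}=\mathbb{R}\cup\{-\infty,\infty\}$. Let $F\in W(\mathbb{R},\mathbb{C})$ be such that $F(z)\neq 0$ for every $z\in\overline{\mathbb{R}}$ and $F(0)=1$. Then the index of $F$, $$m=\frac{1}{2\pi}\Big(\lim_{z\to+\infty}\theta(z)-\lim_{z\to-\infty}\theta(z)\Big),$$ is well defined, where $\theta:\mathbb{R}\to\mathbb{R}$ is any continuous function with $F(z)/|F(z)|=e^{i\theta(z)}$ for all $z\in\mathbb{R}$, and there is a function $g\in L^1(\mathbb{R},\mathbb{C})$ such that, for all $z\in\mathbb{R}$, $$F(z)=\exp\left(\int_{\mathbb{R}}(e^{ixz}-1)\left(g(x)+\frac{m e^{-|x|}}{|x|}\big(\mathbf{1}_{(0,\infty)}(x)-\mathbf{1}_{(-\infty,0)}(x)\big)\right)dx\right),$$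 where the integral converges absolutely. -/

import Mathlib

open Filter Topology MeasureTheory

/-- The space `W(ℝ, ℂ)` of all functions `F(z) = p + ∫ f(x) e^{ixz} dx` with `p ∈ ℂ` and
`f ∈ L¹(ℝ, ℂ)`. -/
def wienerSpace : Set (ℝ → ℂ) :=
  {F | ∃ (p : ℂ) (f : ℝ → ℂ), Integrable f ∧
    ∀ z : ℝ, F z = p + ∫ x : ℝ, f x * Complex.exp (Complex.I * x * z)}

/-- `F` does not vanish on the two-point compactification `[-∞, ∞]` of the real line: `F` has a
(necessarily unique) continuous extension to `[-∞, ∞]`, and this extension has no zeros. -/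
def NonvanishingOnExtendedReals (F : ℝ → ℂ) : Prop :=
  ∃ G : EReal → ℂ, Continuous G ∧ (∀ z : ℝ, G (z : EReal) = F z) ∧ ∀ z : EReal, G z ≠ 0

/-- `θ` is a continuous argument of `F`: `F / |F| = exp (i θ)` on the real line. -/
def IsContinuousArg (F : ℝ → ℂ) (θ : ℝ → ℝ) : Prop :=
  Continuous θ ∧ ∀ x : ℝ, F x / (‖F x‖ : ℂ) = Complex.exp (Complex.I * θ x)

/-- `F` has a continuous argument `θ` with limits at `±∞`, and
`m = (θ(∞) - θ(-∞)) / (2π)`. -/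
def HasIndex (F : ℝ → ℂ) (m : ℝ) : Prop :=
  ∃ (θ : ℝ → ℝ) (a b : ℝ), IsContinuousArg F θ ∧
    Tendsto θ atTop (𝓝 a) ∧ Tendsto θ atBot (𝓝 b) ∧ m = 1 / (2 * Real.pi) * (a - b)

/-- The index does not depend on the choice of the continuous argument. -/
theorem HasIndex.unique {F : ℝ → ℂ} {m m' : ℝ} (h : HasIndex F m) (h' : HasIndex F m') :
    m = m' := by
  obtain ⟨θ, a, b, ⟨hc, hθ⟩, ha, hb, rfl⟩ := h
  obtain ⟨θ', a', b', ⟨hc', hθ'⟩, ha', hb', rfl⟩ := h'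
  have key : ∀ x, ∃ n : ℤ, θ x - θ' x = n * (2 * Real.pi) := by
    intro x
    obtain ⟨n, hn⟩ := Complex.exp_eq_exp_iff_exists_int.1 ((hθ x).symm.trans (hθ' x))
    refine ⟨n, ?_⟩
    have := congrArg Complex.im hn
    simp at this
    linarith
  choose n hn using key
  have hpi := Real.pi_pos
  have hnc : Continuous n := by
    rw [Int.isClosedEmbedding_coe_real.isEmbedding.continuous_iff]
    have : ((fun k : ℤ => (k : ℝ)) ∘ n) = fun x => (θ x - θ' x) / (2 * Real.pi) := by
      funext x
      simp only [Function.comp]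
      rw [hn x]
      field_simp
    rw [this]
    fun_prop
  have hconst : ∀ x, θ x - θ' x = n 0 * (2 * Real.pi) := fun x => by
    rw [hn x, PreconnectedSpace.constant inferInstance hnc (x := x) (y := 0)]
  have e1 : a - a' = n 0 * (2 * Real.pi) :=
    tendsto_nhds_unique (ha.sub ha') (by simp only [hconst]; exact tendsto_const_nhds)
  have e2 : b - b' = n 0 * (2 * Real.pi) :=
    tendsto_nhds_unique (hb.sub hb') (by simp only [hconst]; exact tendsto_const_nhds)
  congr 1
  linarith

open Classical in
/-- The index of `F`: the number `m` with `HasIndex F m` (and `0` if there is none). -/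
noncomputable def index (F : ℝ → ℂ) : ℝ :=
  if h : ∃ m : ℝ, HasIndex F m then h.choose else 0

/-- The density `g(x) + m e^{-|x|} / |x| (1_{(0,∞)}(x) - 1_{(-∞,0)}(x))`. -/
noncomputable def levyDensity (g : ℝ → ℂ) (m : ℝ) (x : ℝ) : ℂ :=
  g x + ((m * Real.exp (-|x|) / |x| *
    ((Set.Ioi 0).indicator (fun _ => 1) x - (Set.Iio 0).indicator (fun _ => 1) x) : ℝ) : ℂ)

/-! Substituting `z = -2πw` turns the Wiener algebra into constants plus Fourier transforms `𝓕 f` of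
integrable functions. The proof is a logarithmic version of Newman's proof of Wiener's lemma and
uses no Gelfand theory.

Write `F = p + 𝓕 f` with `|F| ≥ δ`, approximate `f` in `L¹` by a Schwartz function `g` within `δ/3`,
and put `P = p + 𝓕 g`, which is bounded below by `2δ/3`. Then `F = P · (1 + (F - P)/P)`.

* The second factor has the logarithm `∑ (-1)ⁿ⁺¹ (F - P)ⁿ / (n Pⁿ)`. The `L¹` norm attached to
  `(F - P)ⁿ` is at most `(δ/3)ⁿ`, whereas the norm of `P⁻ⁿ - p⁻ⁿ` is `O(n² (2δ/3)⁻ⁿ)`, because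
  `P` is smooth and two derivatives control the norm (`isFourierBounded_of_hasDerivAt`,
  `exists_isFourierBounded_pow_sub`). Hence the series converges in the algebra, and the logarithm
  is `𝓕 l` with `l` integrable (`exists_fourier_eq_log`).
* The first factor is `P(0) exp (∫₀ʷ u)` with `u = P'/P`. As `u` is smooth and decays, `u = 𝓕 k`
  with `k = 𝓕⁻ u` integrable, and integrating in `w` gives a Lévy representation with density
  `k(x) / (-2πix)` (`intervalIntegral_fourier`).

The limits of `∫₀ʷ u` at `±∞` show that the index `m` exists and that `k(0) = ∫ u = -2πim`
(`exists_hasIndex`). Since `u` has a first moment, `k(x) - k(0) = O(|x|)`, so `k(x) / (-2πix)`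
differs from `m e^{-|x|} / x` by an integrable function (`integrable_fourierInv_div_sub`). Adding
`l` to this difference gives the function `g` of the theorem; the constant in the exponent is fixed
by `F(0) = 1`. -/

open scoped FourierTransform Convolution

/-! ### Fourier transforms of integrable functions with norm bounds -/

lemma norm_fourier_le_integral_norm (f : ℝ → ℂ) (w : ℝ) : ‖𝓕 f w‖ ≤ ∫ x, ‖f x‖ := by
  rw [Real.fourier_eq]
  exact (norm_integral_le_integral_norm _).trans (le_of_eq (by simp))

/-- `G` is the Fourier transform of an integrable function of `L¹` norm at most `C`. This is the
statement that `G` has norm at most `C` in the Wiener algebra, in the normalisation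
`𝓕 f w = ∫ f(x) e^{-2πixw} dx`. -/
def IsFourierBounded (G : ℝ → ℂ) (C : ℝ) : Prop :=
  ∃ f : ℝ → ℂ, Integrable f ∧ ∫ x, ‖f x‖ ≤ C ∧ ∀ w, 𝓕 f w = G w

namespace IsFourierBounded

variable {G H : ℝ → ℂ} {C D : ℝ}

lemma mono (h : IsFourierBounded G C) (hCD : C ≤ D) : IsFourierBounded G D := by
  obtain ⟨f, hf, hC, hG⟩ := h
  exact ⟨f, hf, hC.trans hCD, hG⟩

lemma nonneg (h : IsFourierBounded G C) : 0 ≤ C := by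
  obtain ⟨f, hf, hC, hG⟩ := h
  exact (integral_nonneg fun _ => norm_nonneg _).trans hC

lemma add (hG : IsFourierBounded G C) (hH : IsFourierBounded H D) :
    IsFourierBounded (fun w => G w + H w) (C + D) := by
  obtain ⟨f, hf, hC, hG⟩ := hG
  obtain ⟨g, hg, hD, hH⟩ := hH
  refine ⟨f + g, hf.add hg, ?_, fun w => ?_⟩
  · calc ∫ x, ‖(f + g) x‖ ≤ ∫ x, (‖f x‖ + ‖g x‖) :=
          integral_mono (hf.add hg).norm (hf.norm.add hg.norm) fun x => norm_add_le _ _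
      _ ≤ C + D := by rw [integral_add hf.norm hg.norm]; exact add_le_add hC hD
  · simp only [← hG, ← hH]
    rw [Real.fourier_eq, Real.fourier_eq, Real.fourier_eq, ← integral_add]
    · simp
    · exact (Real.fourierIntegral_convergent_iff w).2 hf
    · exact (Real.fourierIntegral_convergent_iff w).2 hg

lemma const_mul (hG : IsFourierBounded G C) (c : ℂ) :
    IsFourierBounded (fun w => c * G w) (‖c‖ * C) := by
  obtain ⟨f, hf, hC, hG⟩ := hG
  refine ⟨fun x => c * f x, hf.const_mul c, ?_, fun w => ?_⟩
  · simp only [norm_mul, integral_const_mul]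
    gcongr
  · simp only [← hG]
    rw [Real.fourier_eq, Real.fourier_eq, ← integral_const_mul]
    congr 1; ext x
    simp [Circle.smul_def]; ring

/-- The Fourier transform of a convolution is the product, and convolution is submultiplicative
for the `L¹` norm. -/
lemma mul (hG : IsFourierBounded G C) (hH : IsFourierBounded H D) :
    IsFourierBounded (fun w => G w * H w) (C * D) := by
  have hC0 := hG.nonneg
  obtain ⟨f, hf, hC, hG⟩ := hG
  obtain ⟨g, hg, hD, hH⟩ := hH
  refine ⟨f ⋆[ContinuousLinearMap.mul ℂ ℂ] g, hf.integrable_convolution _ hg, ?_, fun w => ?_⟩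
  · calc ∫ x, ‖(f ⋆[ContinuousLinearMap.mul ℂ ℂ] g) x‖
        ≤ ∫ x, ((fun x => ‖f x‖) ⋆[ContinuousLinearMap.mul ℝ ℝ] (fun x => ‖g x‖)) x := by
          refine integral_mono (hf.integrable_convolution _ hg).norm
            (hf.norm.integrable_convolution _ hg.norm) fun x => ?_
          simp only [convolution_def]
          refine (norm_integral_le_integral_norm _).trans (le_of_eq ?_)
          simp
      _ = (∫ x, ‖f x‖) * ∫ x, ‖g x‖ := by
          rw [integral_convolution _ hf.norm hg.norm]; simp
      _ ≤ C * D := by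
          gcongr
  · rw [Real.fourier_mul_convolution_eq hf hg, hG, hH]

lemma pow_succ (hG : IsFourierBounded G C) (n : ℕ) :
    IsFourierBounded (fun w => G w ^ (n + 1)) (C ^ (n + 1)) := by
  induction n with
  | zero => simpa using hG
  | succ n ih => simpa only [_root_.pow_succ _ (n + 1)] using ih.mul hG

/-- An absolutely convergent series of Fourier transforms of integrable functions is the Fourier
transform of an integrable function. -/
lemma exists_of_hasSum {G : ℕ → ℝ → ℂ} {C : ℕ → ℝ} {S : ℝ → ℂ}
    (h : ∀ n, IsFourierBounded (G n) (C n)) (hC : Summable C)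
    (hS : ∀ w, HasSum (fun n => G n w) (S w)) :
    ∃ f : ℝ → ℂ, Integrable f ∧ ∀ w, 𝓕 f w = S w := by
  choose f hf hfC hfG using h
  have hsum : Summable fun n => ∫ x, ‖f n x‖ :=
    hC.of_nonneg_of_le (fun n => integral_nonneg fun _ => norm_nonneg _) hfC
  have hlin : ∑' n, ∫⁻ x, ‖f n x‖ₑ ≠ ⊤ := by
    have (n : ℕ) : ∫⁻ x, ‖f n x‖ₑ = ENNReal.ofReal (∫ x, ‖f n x‖) :=
      (ofReal_integral_norm_eq_lintegral_enorm (hf n)).symm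
    simp only [this]
    rw [← ENNReal.ofReal_tsum_of_nonneg (fun n => integral_nonneg fun _ => norm_nonneg _) hsum]
    exact ENNReal.ofReal_ne_top
  have hae : ∀ᵐ x, Summable fun n => ‖f n x‖ :=
    summable_norm_of_tsum_eLpNorm_ne_top le_rfl (fun n => (hf n).1)
      (by simpa only [eLpNorm_one_eq_lintegral_enorm] using hlin)
  have hint : Integrable (fun x => ∑' n, f n x) := by
    refine ⟨aestronglyMeasurable_of_tendsto_ae atTop
      (f := fun N x => ∑ n ∈ Finset.range N, f n x)
      (fun N => Finset.aestronglyMeasurable_fun_sum _ fun n _ => (hf n).1) ?_, ?_⟩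
    · filter_upwards [hae] with x hx using hx.of_norm.hasSum.tendsto_sum_nat
    · refine lt_of_le_of_lt (lintegral_mono fun x => enorm_tsum_le_tsum_enorm) ?_
      rw [lintegral_tsum fun n => (hf n).1.enorm]
      exact hlin.lt_top
  refine ⟨fun x => ∑' n, f n x, hint, fun w => HasSum.unique ?_ (hS w)⟩
  have key := hasSum_integral_of_summable_integral_norm (μ := volume)
    (F := fun n x => Real.fourierChar (-inner ℝ x w) • f n x)
    (fun n => (Real.fourierIntegral_convergent_iff w).2 (hf n)) (by simpa using hsum)
  simp only [← hfG, Real.fourier_eq]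
  convert! key using 3 with x
  simp only [Circle.smul_def, smul_eq_mul, tsum_mul_left]

end IsFourierBounded

/-- If `h`, `h'` and `h''` are integrable, then `h` is the Fourier transform of its inverse
transform, which is `O(1 / (1 + x²))` with constant `‖h‖₁ + ‖h''‖₁`. -/
lemma isFourierBounded_of_hasDerivAt {h h₁ h₂ : ℝ → ℂ}
    (hh : ∀ x, HasDerivAt h (h₁ x) x) (hh₁ : ∀ x, HasDerivAt h₁ (h₂ x) x)
    (i0 : Integrable h) (i1 : Integrable h₁) (i2 : Integrable h₂) :
    IsFourierBounded h (Real.pi * ((∫ x, ‖h x‖) + ∫ x, ‖h₂ x‖)) ∧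
      Integrable (𝓕⁻ h) ∧ ∀ w, 𝓕 (𝓕⁻ h) w = h w := by
  have d0 : deriv h = h₁ := funext fun x => (hh x).deriv
  have d1 : deriv h₁ = h₂ := funext fun x => (hh₁ x).deriv
  have e1 := Real.fourier_deriv i0 (fun x => (hh x).differentiableAt) (d0 ▸ i1)
  have e2 := Real.fourier_deriv i1 (fun x => (hh₁ x).differentiableAt) (d1 ▸ i2)
  rw [d0] at e1
  rw [d1, e1] at e2
  set M := (∫ x, ‖h x‖) + ∫ x, ‖h₂ x‖ with hM
  have hcont : Continuous h := continuous_iff_continuousAt.2 fun x => (hh x).continuousAt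
  have bound (w : ℝ) : ‖𝓕 h w‖ ≤ M * (1 + w ^ 2)⁻¹ := by
    have b0 := norm_fourier_le_integral_norm h w
    have b2 : w ^ 2 * ‖𝓕 h w‖ ≤ ∫ x, ‖h₂ x‖ := by
      refine le_trans ?_ (norm_fourier_le_integral_norm h₂ w)
      have : ‖𝓕 h₂ w‖ = (2 * Real.pi) ^ 2 * (w ^ 2 * ‖𝓕 h w‖) := by
        rw [congrFun e2 w]
        simp only [smul_eq_mul, norm_mul, Complex.norm_real, Complex.norm_I, Complex.norm_ofNat,
          Real.norm_eq_abs, abs_of_pos Real.pi_pos]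
        rw [← sq_abs w]
        ring
      rw [this]
      have hpi := Real.pi_gt_three
      exact le_mul_of_one_le_left (by positivity) (by nlinarith)
    rw [← div_eq_mul_inv, le_div_iff₀ (by positivity)]
    linarith
  have hFi : Integrable (𝓕 h) :=
    (integrable_inv_one_add_sq.const_mul M).mono'
      (VectorFourier.fourierIntegral_continuous Real.continuous_fourierChar
        (by exact continuous_inner) i0).aestronglyMeasurable (.of_forall bound)
  have hinv : 𝓕⁻ h = fun x => 𝓕 h (-x) := funext fun x => Real.fourierInv_eq_fourier_neg h x
  have hIi : Integrable (𝓕⁻ h) := by rw [hinv]; exact hFi.comp_neg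
  have heq := hcont.fourier_fourierInv_eq i0 hFi
  refine ⟨⟨𝓕⁻ h, hIi, ?_, congrFun heq⟩, hIi, congrFun heq⟩
  rw [hinv, integral_neg_eq_self (fun x => ‖𝓕 h x‖), mul_comm, ← integral_univ_inv_one_add_sq,
    ← integral_const_mul]
  exact integral_mono hFi.norm (integrable_inv_one_add_sq.const_mul M) bound

/-! ### Logarithms of small perturbations -/

lemma norm_pow_succ_sub_pow_succ_le {a b : ℂ} {ρ : ℝ} (ha : ‖a‖ ≤ ρ) (hb : ‖b‖ ≤ ρ) (n : ℕ) :
    ‖a ^ (n + 1) - b ^ (n + 1)‖ ≤ (n + 1) * ρ ^ n * ‖a - b‖ := by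
  induction n with
  | zero => simp
  | succ n ih =>
    have hρ : 0 ≤ ρ := (norm_nonneg a).trans ha
    calc ‖a ^ (n + 1 + 1) - b ^ (n + 1 + 1)‖
        = ‖a * (a ^ (n + 1) - b ^ (n + 1)) + (a - b) * b ^ (n + 1)‖ := by ring_nf
      _ ≤ ‖a‖ * ‖a ^ (n + 1) - b ^ (n + 1)‖ + ‖a - b‖ * ‖b‖ ^ (n + 1) := by
          refine (norm_add_le _ _).trans ?_
          simp
      _ ≤ ρ * ((n + 1) * ρ ^ n * ‖a - b‖) + ‖a - b‖ * ρ ^ (n + 1) := by gcongr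
      _ = _ := by push_cast; ring

/-- A smooth function `r` with values in the disc of radius `ρ` has powers whose norms in the
Wiener algebra grow like `n² ρⁿ`: differentiating `rⁿ` twice costs only a factor `n²`. -/
lemma exists_isFourierBounded_pow_sub {r r₁ r₂ : ℝ → ℂ} {q : ℂ} {ρ : ℝ} (hρ : 0 < ρ)
    (hr : ∀ x, HasDerivAt r (r₁ x) x) (hr₁ : ∀ x, HasDerivAt r₁ (r₂ x) x)
    (hrρ : ∀ x, ‖r x‖ ≤ ρ) (hqρ : ‖q‖ ≤ ρ)
    (i0 : Integrable fun x => r x - q) (i1 : Integrable r₁) (i2 : Integrable r₂)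
    (i11 : Integrable fun x => r₁ x ^ 2) :
    ∃ K, 0 ≤ K ∧ ∀ n : ℕ, IsFourierBounded (fun x => r x ^ (n + 1) - q ^ (n + 1))
      (K * ((n + 1) ^ 2 * ρ ^ n)) := by
  have hcont : Continuous r := continuous_iff_continuousAt.2 fun x => (hr x).continuousAt
  have bdd (n : ℕ) : ∀ᵐ x : ℝ, ‖r x ^ n‖ ≤ ρ ^ n := .of_forall fun x => by
    rw [norm_pow]; gcongr; exact hrρ x
  have mulI {g : ℝ → ℂ} (n : ℕ) (hg : Integrable g) : Integrable fun x => r x ^ n * g x :=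
    hg.bdd_mul (hcont.pow n).aestronglyMeasurable (bdd n)
  set A := ∫ x, ‖r x - q‖
  set B := ∫ x, ‖r₁ x ^ 2‖
  set D := ∫ x, ‖r₂ x‖
  have hA : 0 ≤ A := integral_nonneg fun _ => norm_nonneg _
  have hB : 0 ≤ B := integral_nonneg fun _ => norm_nonneg _
  have hD : 0 ≤ D := integral_nonneg fun _ => norm_nonneg _
  have hpi := Real.pi_pos
  refine ⟨Real.pi * (A + (ρ⁻¹ * B + D)), by positivity, fun n => ?_⟩
  have i0' : Integrable fun x => r x ^ (n + 1) - q ^ (n + 1) := by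
    refine (i0.norm.const_mul ((n + 1) * ρ ^ n)).mono' ?_
      (.of_forall fun x => norm_pow_succ_sub_pow_succ_le (hrρ x) hqρ n)
    exact ((hcont.pow _).sub continuous_const).aestronglyMeasurable
  have d0 (x : ℝ) : HasDerivAt (fun x => r x ^ (n + 1) - q ^ (n + 1))
      ((n + 1) * (r x ^ n * r₁ x)) x := by
    convert! ((hr x).pow (n + 1)).sub_const (q ^ (n + 1)) using 1
    push_cast [Nat.add_sub_cancel]; ring
  have d1 (x : ℝ) : HasDerivAt (fun x => (n + 1) * (r x ^ n * r₁ x))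
      ((n + 1) * (n * (r x ^ (n - 1) * r₁ x ^ 2) + r x ^ n * r₂ x)) x := by
    convert! (((hr x).pow n).mul (hr₁ x)).const_mul ((n : ℂ) + 1) using 1
    simp only [Pi.pow_apply]; ring
  have i1' := (mulI n i1).const_mul ((n : ℂ) + 1)
  have i2a := (mulI (n - 1) i11).const_mul (n : ℂ)
  have i2b := mulI n i2
  have i2' := (i2a.add i2b).const_mul ((n : ℂ) + 1)
  refine (isFourierBounded_of_hasDerivAt d0 d1 i0' i1' i2').1.mono ?_
  have b0 : ∫ x, ‖r x ^ (n + 1) - q ^ (n + 1)‖ ≤ (n + 1) * ρ ^ n * A := by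
    rw [← integral_const_mul]
    exact integral_mono i0'.norm (i0.norm.const_mul _) fun x =>
      norm_pow_succ_sub_pow_succ_le (hrρ x) hqρ n
  have b2 : ∫ x, ‖((n : ℂ) + 1) * (n * (r x ^ (n - 1) * r₁ x ^ 2) + r x ^ n * r₂ x)‖ ≤
      (n + 1) * (n * ρ ^ (n - 1) * B + ρ ^ n * D) := by
    rw [← integral_const_mul, ← integral_const_mul, ← integral_add (i11.norm.const_mul _)
      (i2.norm.const_mul _), ← integral_const_mul]
    refine integral_mono i2'.norm
      (((i11.norm.const_mul _).add (i2.norm.const_mul _)).const_mul _) fun x => ?_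
    have hn : ‖(n : ℂ) + 1‖ = n + 1 := by
      rw [← Nat.cast_succ, Complex.norm_natCast]; push_cast; rfl
    simp only [norm_mul, hn]
    gcongr
    refine (norm_add_le _ _).trans ?_
    simp only [norm_mul, norm_pow, Complex.norm_natCast, mul_assoc]
    have := norm_nonneg (r x)
    gcongr <;> exact hrρ x
  have b3 : (n : ℝ) * ρ ^ (n - 1) = n * ρ ^ n * ρ⁻¹ := by
    rcases n with _ | n
    · simp
    · rw [Nat.add_sub_cancel, _root_.pow_succ]; field_simp
  calc Real.pi * ((∫ x, ‖r x ^ (n + 1) - q ^ (n + 1)‖) +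
        ∫ x, ‖((n : ℂ) + 1) * (n * (r x ^ (n - 1) * r₁ x ^ 2) + r x ^ n * r₂ x)‖)
      ≤ Real.pi * ((n + 1) * ρ ^ n * A + (n + 1) * (n * ρ ^ (n - 1) * B + ρ ^ n * D)) := by
        gcongr
    _ = Real.pi * ((n + 1) * ρ ^ n) * (A * 1 + (n * (ρ⁻¹ * B) + 1 * D)) := by rw [b3]; ring
    _ ≤ Real.pi * ((n + 1) * ρ ^ n) *
        (A * (n + 1) + ((n + 1) * (ρ⁻¹ * B) + (n + 1) * D)) := by
        have : (0 : ℝ) ≤ n := n.cast_nonneg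
        gcongr <;> linarith
    _ = _ := by ring

lemma IsFourierBounded.norm_le {G : ℝ → ℂ} {C : ℝ} (hG : IsFourierBounded G C) (w : ℝ) :
    ‖G w‖ ≤ C := by
  obtain ⟨f, -, hC, hG⟩ := hG
  rw [← hG]
  exact (norm_fourier_le_integral_norm f w).trans hC

/-- Newman's argument for logarithms: if `φ` is small in the Wiener algebra and `r` is smooth with
`‖φ‖ · sup |r| < 1`, then the Taylor series of `log (1 + φ r)` converges in the Wiener algebra,
although the norm of `φ r` itself may be large. -/
lemma exists_fourier_eq_log {φ r r₁ r₂ : ℝ → ℂ} {q : ℂ} {ε ρ : ℝ} (hρ : 0 < ρ)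
    (hφ : IsFourierBounded φ ε) (hερ : ε * ρ < 1)
    (hr : ∀ x, HasDerivAt r (r₁ x) x) (hr₁ : ∀ x, HasDerivAt r₁ (r₂ x) x)
    (hrρ : ∀ x, ‖r x‖ ≤ ρ) (hqρ : ‖q‖ ≤ ρ)
    (i0 : Integrable fun x => r x - q) (i1 : Integrable r₁) (i2 : Integrable r₂)
    (i11 : Integrable fun x => r₁ x ^ 2) :
    ∃ f : ℝ → ℂ, Integrable f ∧ ∀ w, 𝓕 f w = Complex.log (1 + φ w * r w) := by
  obtain ⟨K, hK, hpow⟩ := exists_isFourierBounded_pow_sub hρ hr hr₁ hrρ hqρ i0 i1 i2 i11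
  have hε := hφ.nonneg
  have hφr (w : ℝ) : ‖φ w * r w‖ < 1 := by
    rw [norm_mul]
    exact (mul_le_mul (hφ.norm_le w) (hrρ w) (norm_nonneg _) hε).trans_lt hερ
  -- The constant part `q` of `r` is split off, because it is not a Fourier transform.
  have hterm (n : ℕ) : IsFourierBounded
      (fun w => ((-1) ^ (n + 1 + 1) / ((n + 1 : ℕ) : ℂ)) *
        (φ w ^ (n + 1) * (r w ^ (n + 1) - q ^ (n + 1)) + q ^ (n + 1) * φ w ^ (n + 1)))
      (K * ε * (((n + 1 : ℕ) : ℝ) ^ 2 * (ε * ρ) ^ n) + ρ * ε * (ε * ρ) ^ n) := by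
    refine ((((hφ.pow_succ n).mul (hpow n)).add
      ((hφ.pow_succ n).const_mul (q ^ (n + 1)))).const_mul _).mono ?_
    have h1 : ‖(-1 : ℂ) ^ (n + 1 + 1) / ((n + 1 : ℕ) : ℂ)‖ ≤ 1 := by
      rw [norm_div, norm_pow, norm_neg, norm_one, one_pow, Complex.norm_natCast]
      exact div_le_one_of_le₀ (by simp) (by positivity)
    calc _ ≤ 1 * (ε ^ (n + 1) * (K * ((n + 1) ^ 2 * ρ ^ n)) + ρ ^ (n + 1) * ε ^ (n + 1)) := by
          rw [norm_pow]; gcongr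
      _ = _ := by push_cast; ring
  have habs : ‖ε * ρ‖ < 1 := by rwa [Real.norm_of_nonneg (by positivity)]
  have hsum : Summable fun n : ℕ =>
      K * ε * (((n + 1 : ℕ) : ℝ) ^ 2 * (ε * ρ) ^ n) + ρ * ε * (ε * ρ) ^ n := by
    refine (Summable.mul_left _ ?_).add ((summable_geometric_of_norm_lt_one habs).mul_left _)
    have h2 := summable_pow_mul_geometric_of_norm_lt_one 2 habs
    have h1 := summable_pow_mul_geometric_of_norm_lt_one 1 habs
    have h0 := summable_pow_mul_geometric_of_norm_lt_one 0 habs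
    refine ((h2.add (h1.mul_left 2)).add h0).congr fun n => ?_
    push_cast; ring
  refine IsFourierBounded.exists_of_hasSum hterm hsum fun w => ?_
  have := (hasSum_nat_add_iff' 1).2 (Complex.hasSum_taylorSeries_log (hφr w))
  simp only [Finset.sum_range_one, Nat.cast_zero, div_zero, sub_zero] at this
  convert! this using 2 with n
  rw [mul_pow]; ring

/-! ### Schwartz perturbations of a constant -/

section SchwartzPerturbation

open scoped SchwartzMap BoundedContinuousFunction

lemma SchwartzMap.integrable_mul_boundedContinuousFunction (σ : 𝓢(ℝ, ℂ)) (b : ℝ →ᵇ ℂ) :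
    Integrable fun x => σ x * b x :=
  σ.integrable.mul_bdd b.continuous.aestronglyMeasurable (.of_forall b.norm_coe_le_norm)

lemma SchwartzMap.hasDerivAt_derivCLM (σ : 𝓢(ℝ, ℂ)) (x : ℝ) :
    HasDerivAt σ (SchwartzMap.derivCLM ℂ ℂ σ x) x :=
  σ.differentiableAt.hasDerivAt

variable (s : 𝓢(ℝ, ℂ)) {p : ℂ} {δ : ℝ}

/-- For a Schwartz function `s` and a constant `p` such that `P = p + s` is bounded away from `0`,
the reciprocal of `P` has the regularity under which the logarithm series of a small perturbation
of `P` can be summed, and the logarithmic derivative of `P` is the Fourier transform of an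
integrable function and has a finite first moment. -/
lemma exists_logDeriv_and_log (hδ : 0 < δ) (hp : δ ≤ ‖p‖) (hP : ∀ x, δ ≤ ‖p + s x‖) :
    (∃ u : ℝ → ℂ, Continuous u ∧ Integrable u ∧ Integrable (fun x => x * u x) ∧
      (∀ x, HasDerivAt s (u x * (p + s x)) x) ∧ Integrable (𝓕⁻ u) ∧ ∀ w, 𝓕 (𝓕⁻ u) w = u w) ∧
    ∀ (φ : ℝ → ℂ) (ε : ℝ), IsFourierBounded φ ε → ε < δ →
      ∃ f : ℝ → ℂ, Integrable f ∧ ∀ w, 𝓕 f w = Complex.log (1 + φ w * (p + s w)⁻¹) := by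
  have hP0 (x : ℝ) : p + s x ≠ 0 := norm_pos_iff.1 (hδ.trans_le (hP x))
  have hp0 : p ≠ 0 := norm_pos_iff.1 (hδ.trans_le hp)
  have hrδ (x : ℝ) : ‖(p + s x)⁻¹‖ ≤ δ⁻¹ := by
    rw [norm_inv]; exact inv_anti₀ hδ (hP x)
  have hqδ : ‖p⁻¹‖ ≤ δ⁻¹ := by
    rw [norm_inv]; exact inv_anti₀ hδ hp
  let s₁ := SchwartzMap.derivCLM ℂ ℂ s
  let s₂ := SchwartzMap.derivCLM ℂ ℂ s₁
  let s₃ := SchwartzMap.derivCLM ℂ ℂ s₂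
  let b₁ := s₁.toBoundedContinuousFunction
  let r : ℝ →ᵇ ℂ := BoundedContinuousFunction.ofNormedAddCommGroup (fun x => (p + s x)⁻¹)
    ((continuous_const.add s.continuous).inv₀ hP0) δ⁻¹ hrδ
  have hPr (x : ℝ) : (p + s x) * r x = 1 := mul_inv_cancel₀ (hP0 x)
  let r₁ : ℝ →ᵇ ℂ := -(b₁ * (r * r))
  let r₂ : ℝ →ᵇ ℂ := -(s₂.toBoundedContinuousFunction * (r * r) + b₁ * (r₁ * r + r * r₁))
  have hs (x : ℝ) : HasDerivAt s (s₁ x) x := s.hasDerivAt_derivCLM x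
  have hs₁ (x : ℝ) : HasDerivAt s₁ (s₂ x) x := s₁.hasDerivAt_derivCLM x
  have hs₂ (x : ℝ) : HasDerivAt s₂ (s₃ x) x := s₂.hasDerivAt_derivCLM x
  have hr (x : ℝ) : HasDerivAt r (r₁ x) x := by
    convert! ((hs x).const_add p).inv (hP0 x) using 1
    change -(s₁ x * ((p + s x)⁻¹ * (p + s x)⁻¹)) = _
    field_simp
  have hr₁ (x : ℝ) : HasDerivAt r₁ (r₂ x) x :=
    ((hs₁ x).mul ((hr x).mul (hr x))).neg
  refine ⟨⟨fun x => s₁ x * r x, s₁.continuous.mul r.continuous,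
    s₁.integrable_mul_boundedContinuousFunction r, ?_, fun x => ?_, ?_⟩, fun φ ε hφ hε => ?_⟩
  · have : Integrable fun x : ℝ => (x : ℂ) * s₁ x := by
      refine (s₁.integrable_pow_mul volume 1).mono
        (Complex.continuous_ofReal.mul s₁.continuous).aestronglyMeasurable
        (.of_forall fun x => by simp)
    refine (this.mul_bdd r.continuous.aestronglyMeasurable
      (.of_forall r.norm_coe_le_norm)).congr (.of_forall fun x => mul_assoc _ _ _)
  · convert! hs x using 1
    linear_combination s₁ x * hPr x
  · have d0 (x : ℝ) : HasDerivAt (fun x => s₁ x * r x) (s₂ x * r x + s₁ x * r₁ x) x :=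
      (hs₁ x).mul (hr x)
    have d1 (x : ℝ) : HasDerivAt (fun x => s₂ x * r x + s₁ x * r₁ x)
        ((s₃ x * r x + s₂ x * r₁ x) + (s₂ x * r₁ x + s₁ x * r₂ x)) x :=
      ((hs₂ x).mul (hr x)).add ((hs₁ x).mul (hr₁ x))
    have I (σ : 𝓢(ℝ, ℂ)) (b : ℝ →ᵇ ℂ) := σ.integrable_mul_boundedContinuousFunction b
    exact (isFourierBounded_of_hasDerivAt d0 d1 (I s₁ r) ((I s₂ r).add (I s₁ r₁))
      (((I s₃ r).add (I s₂ r₁)).add ((I s₂ r₁).add (I s₁ r₂)))).2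
  · refine exists_fourier_eq_log (r := r) (q := p⁻¹) (inv_pos.2 hδ) hφ ?_ hr hr₁ hrδ hqδ
      ?_ ?_ ?_ ?_
    · rwa [← div_eq_mul_inv, div_lt_one hδ]
    · refine (s.integrable_mul_boundedContinuousFunction (-(p⁻¹ • r))).congr
        (.of_forall fun x => ?_)
      change s x * -(p⁻¹ * (p + s x)⁻¹) = (p + s x)⁻¹ - p⁻¹
      have := hP0 x
      field_simp
      ring
    · exact (s₁.integrable_mul_boundedContinuousFunction (-(r * r))).congr
        (.of_forall fun x => by simp [r₁, b₁])
    · refine ((s₂.integrable_mul_boundedContinuousFunction (-(r * r))).add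
        (s₁.integrable_mul_boundedContinuousFunction (-(r₁ * r + r * r₁)))).congr
        (.of_forall fun x => ?_)
      simp [r₂, b₁]
      ring
    · refine (s₁.integrable_mul_boundedContinuousFunction (-(r * r) * r₁)).congr
        (.of_forall fun x => ?_)
      simp [r₁, b₁]
      ring

end SchwartzPerturbation

/-! ### Lévy densities of primitives -/

lemma integrable_exp_neg_abs : Integrable fun x : ℝ => Real.exp (-|x|) := by
  refine (integrable_inv_one_add_sq.const_mul 2).mono' (by fun_prop) (.of_forall fun x => ?_)
  rw [Real.norm_of_nonneg (Real.exp_pos _).le, Real.exp_neg, ← div_eq_mul_inv,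
    inv_eq_one_div, div_le_div_iff₀ (Real.exp_pos _) (by positivity)]
  have := Real.quadratic_le_exp_of_nonneg (abs_nonneg x)
  rw [sq_abs] at this
  linarith [abs_nonneg x]

/-- Division by `x` costs nothing where `|x| ≥ 1`, and gives a bounded function near the origin. -/
lemma integrable_div_of_norm_le_mul_abs {ψ : ℝ → ℂ} {M : ℝ} (hψ : Integrable ψ)
    (hM : ∀ x, ‖ψ x‖ ≤ M * |x|) : Integrable fun x : ℝ => ψ x / x := by
  have hind : Integrable ((Set.Icc (-1 : ℝ) 1).indicator fun _ => M) := by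
    rw [integrable_indicator_iff measurableSet_Icc]
    exact integrableOn_const (by simp)
  refine (hind.add hψ.norm).mono'
    (hψ.1.aemeasurable.div Complex.measurable_ofReal.aemeasurable).aestronglyMeasurable
    (.of_forall fun x => ?_)
  rw [norm_div, Complex.norm_real, Real.norm_eq_abs, Pi.add_apply]
  by_cases hx : x ∈ Set.Icc (-1 : ℝ) 1
  · rw [Set.indicator_of_mem hx]
    have hM0 : 0 ≤ M := by simpa using (norm_nonneg _).trans (hM 1)
    linarith [div_le_of_le_mul₀ (abs_nonneg x) hM0 (hM x), norm_nonneg (ψ x)]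
  · rw [Set.indicator_of_notMem hx, zero_add]
    have : 1 ≤ |x| := by
      by_contra! h
      exact hx ⟨(abs_lt.1 h).1.le, (abs_lt.1 h).2.le⟩
    exact div_le_self (norm_nonneg _) this

/-- Integrating `𝓕 k` from `0` to `w` divides `k` by `-2πix`, which produces a Lévy density. -/
lemma intervalIntegral_fourier {k : ℝ → ℂ} (hk : Integrable k) (w : ℝ) :
    Integrable (fun x : ℝ => (Complex.exp (-2 * Real.pi * Complex.I * x * w) - 1) *
        (k x / (-2 * Real.pi * Complex.I * x))) ∧
      ∫ t in (0 : ℝ)..w, 𝓕 k t =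
        ∫ x : ℝ, (Complex.exp (-2 * Real.pi * Complex.I * x * w) - 1) *
          (k x / (-2 * Real.pi * Complex.I * x)) := by
  have hint : Integrable (Function.uncurry fun (t x : ℝ) =>
      Complex.exp (-2 * Real.pi * Complex.I * x * t) * k x)
      ((volume.restrict (Set.uIoc 0 w)).prod volume) := by
    have h0 : Integrable (fun _ : ℝ => (1 : ℂ)) (volume.restrict (Set.uIoc 0 w)) :=
      integrableOn_const (by simp [Set.uIoc])
    have h1 := h0.mul_prod hk
    refine h1.mono ?_ (.of_forall fun z => ?_)
    · refine AEStronglyMeasurable.mul ?_ hk.1.comp_snd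
      exact Continuous.aestronglyMeasurable (by fun_prop)
    · simp only [Function.uncurry, norm_mul, Complex.norm_exp, norm_one]
      simp
  -- The formula for the inner integral can fail only at `x = 0`, where the right-hand side is `0`.
  have hval : ∀ᵐ x : ℝ, ∫ t in (0 : ℝ)..w, Complex.exp (-2 * Real.pi * Complex.I * x * t) * k x =
      (Complex.exp (-2 * Real.pi * Complex.I * x * w) - 1) *
        (k x / (-2 * Real.pi * Complex.I * x)) := by
    filter_upwards [Measure.ae_ne volume (0 : ℝ)] with x hx
    have hc : -2 * Real.pi * Complex.I * (x : ℂ) ≠ 0 := by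
      simp [hx, Real.pi_ne_zero]
    rw [intervalIntegral.integral_mul_const, integral_exp_mul_complex hc]
    simp
    ring
  constructor
  -- `∫ t in 0..w` is the integral over the unordered interval up to a sign.
  · have h2 := hint.integral_prod_right
    refine ((h2.smul (if (0 : ℝ) ≤ w then (1 : ℝ) else -1)).congr ?_)
    filter_upwards [hval] with x hx
    rw [← hx, intervalIntegral.intervalIntegral_eq_integral_uIoc]
    rfl
  · rw [← integral_congr_ae hval, ← intervalIntegral_integral_swap hint]
    refine intervalIntegral.integral_congr fun t _ => ?_
    simp only [Real.fourier_real_eq_integral_exp_smul, smul_eq_mul]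
    congr 1; ext x
    push_cast
    ring_nf

/-- A function with a finite first moment has a transform that is Lipschitz at the origin. -/
lemma norm_fourierInv_sub_le {u : ℝ → ℂ} (hu : Integrable u)
    (hxu : Integrable fun x : ℝ => x * u x) (x : ℝ) :
    ‖𝓕⁻ u x - ∫ t, u t‖ ≤ (2 * Real.pi * ∫ t : ℝ, ‖t * u t‖) * |x| := by
  have i1 := (Real.fourierIntegral_convergent_iff (-x)).2 hu
  rw [Real.fourierInv_eq_fourier_neg, Real.fourier_eq, ← integral_sub i1 hu]
  refine (norm_integral_le_of_norm_le (hxu.norm.const_mul (2 * Real.pi * |x|))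
    (.of_forall fun t => ?_)).trans (le_of_eq ?_)
  · have : (Real.fourierChar (-inner ℝ t (-x)) : ℂ) =
        Complex.exp (Complex.I * ((2 * Real.pi * (x * t) : ℝ) : ℂ)) := by
      rw [Real.fourierChar_apply]
      simp
      ring_nf
    rw [Circle.smul_def, this, smul_eq_mul]
    calc _ = ‖Complex.exp (Complex.I * ((2 * Real.pi * (x * t) : ℝ) : ℂ)) - 1‖ * ‖u t‖ := by
          rw [← norm_mul]; ring_nf
      _ ≤ ‖2 * Real.pi * (x * t)‖ * ‖u t‖ := by
          gcongr; exact Real.norm_exp_I_mul_ofReal_sub_one_le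
      _ = _ := by
          simp only [norm_mul, Real.norm_eq_abs, Complex.norm_real, abs_of_pos Real.pi_pos]
          simp
          ring
  · rw [integral_const_mul]; ring

/-- A solution of `P' = u P` is the exponential of a primitive of `u`, because the quotient of the
two has derivative zero. -/
lemma exp_intervalIntegral_of_hasDerivAt {P u : ℝ → ℂ} (hu : Continuous u)
    (hP : ∀ x, HasDerivAt P (u x * P x) x) (w : ℝ) :
    P w = P 0 * Complex.exp (∫ t in (0 : ℝ)..w, u t) := by
  have hL (x : ℝ) : HasDerivAt (fun x => ∫ t in (0 : ℝ)..x, u t) (u x) x :=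
    intervalIntegral.integral_hasDerivAt_right (hu.intervalIntegrable _ _)
      (hu.stronglyMeasurableAtFilter _ _) hu.continuousAt
  have hQ (x : ℝ) : HasDerivAt (fun x => P x * Complex.exp (-∫ t in (0 : ℝ)..x, u t)) 0 x := by
    convert! (hP x).mul (hL x).neg.cexp using 1
    ring
  have := is_const_of_deriv_eq_zero (fun x => (hQ x).differentiableAt)
    (fun x => (hQ x).deriv) w 0
  simp only [intervalIntegral.integral_same, neg_zero, Complex.exp_zero, mul_one] at this
  rw [← this, mul_assoc, ← Complex.exp_add]
  simp

/-! ### Factorization, index and density -/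

lemma fourier_eq_integral_cexp (f : ℝ → ℂ) (w : ℝ) :
    𝓕 f w = ∫ x : ℝ, f x * Complex.exp (-2 * Real.pi * Complex.I * x * w) := by
  rw [Real.fourier_real_eq_integral_exp_smul]
  congr 1; ext x
  rw [smul_eq_mul, mul_comm]
  push_cast
  ring_nf

lemma NonvanishingOnExtendedReals.exists_pos_le_norm {F : ℝ → ℂ}
    (h : NonvanishingOnExtendedReals F) : ∃ δ > 0, ∀ z, δ ≤ ‖F z‖ := by
  obtain ⟨G, hG, hGF, hG0⟩ := h
  obtain ⟨z₀, -, hz₀⟩ := isCompact_univ.exists_isMinOn ⟨(0 : EReal), trivial⟩ hG.norm.continuousOn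
  exact ⟨‖G z₀‖, norm_pos_iff.2 (hG0 z₀), fun z => hGF z ▸ hz₀ (Set.mem_univ (z : EReal))⟩

lemma exists_schwartz_integral_norm_sub_le {f : ℝ → ℂ} (hf : Integrable f) {ε : ℝ} (hε : 0 < ε) :
    ∃ g : SchwartzMap ℝ ℂ, ∫ x, ‖f x - g x‖ ≤ ε := by
  obtain ⟨g, hg₁, hg₂, hg₃⟩ := (memLp_one_iff_integrable.2 hf).exist_eLpNorm_sub_le
    ENNReal.one_ne_top le_rfl hε
  refine ⟨hg₁.toSchwartzMap hg₂, ?_⟩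
  have hint : Integrable fun x => f x - g x :=
    hf.sub (hg₂.continuous.integrable_of_hasCompactSupport hg₁)
  rw [eLpNorm_one_eq_lintegral_enorm] at hg₃
  change ∫ x, ‖f x - g x‖ ≤ ε
  rw [integral_norm_eq_lintegral_enorm hint.1]
  exact ENNReal.toReal_le_of_le_ofReal hε.le hg₃

/-- Every function of the Wiener algebra that is bounded away from zero is the exponential of a
constant, plus a primitive of a function `u` that has a first moment and an integrable inverse
transform, plus the Fourier transform of an integrable function. The primitive carries the winding
of `F`. -/
lemma exists_fourier_factorization {F : ℝ → ℂ} {p : ℂ} {f : ℝ → ℂ} {δ : ℝ} (hf : Integrable f)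
    (hF : ∀ w, F w = p + 𝓕 f w) (hδ : 0 < δ) (hFδ : ∀ w, δ ≤ ‖F w‖) :
    ∃ (u l : ℝ → ℂ) (c : ℂ), Continuous u ∧ Integrable u ∧ Integrable (fun x => x * u x) ∧
      Integrable (𝓕⁻ u) ∧ (∀ w, 𝓕 (𝓕⁻ u) w = u w) ∧ Integrable l ∧
      ∀ w, F w = Complex.exp (c + (∫ t in (0 : ℝ)..w, u t) + 𝓕 l w) := by
  -- The error `δ / 3` leaves the lower bound `2δ / 3` for the approximation, which is larger.
  obtain ⟨g, hg⟩ := exists_schwartz_integral_norm_sub_le hf (show 0 < δ / 3 by positivity)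
  set s := 𝓕 g with hs
  have hφ : IsFourierBounded (fun w => F w - (p + s w)) (δ / 3) := by
    refine ⟨fun x => f x - g x, hf.sub g.integrable, hg, fun w => ?_⟩
    have i1 := (Real.fourierIntegral_convergent_iff w).2 hf
    have i2 := (Real.fourierIntegral_convergent_iff w).2 (g.integrable (μ := volume))
    change _ = F w - (p + s w)
    rw [hF, hs, SchwartzMap.fourier_coe, Real.fourier_eq, Real.fourier_eq, Real.fourier_eq,
      add_sub_add_left_eq_sub, ← integral_sub i1 i2]
    simp only [smul_sub]
  have hP (w : ℝ) : 2 * (δ / 3) ≤ ‖p + s w‖ := by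
    have h1 := hφ.norm_le w
    have h2 := hFδ w
    have h3 := norm_sub_norm_le (F w) (p + s w)
    linarith
  have hp : 2 * (δ / 3) ≤ ‖p‖ := by
    have : Tendsto (fun w => ‖p + s w‖) atTop (𝓝 ‖p + 0‖) :=
      (tendsto_const_nhds.add ((Real.zero_at_infty_fourier g).mono_left
        atTop_le_cocompact)).norm
    rw [add_zero] at this
    exact ge_of_tendsto' this hP
  obtain ⟨⟨u, hu, hui, hxu, hsu, hki, hku⟩, hlog⟩ :=
    exists_logDeriv_and_log s (show 0 < 2 * (δ / 3) by positivity) hp hP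
  obtain ⟨l, hl, hll⟩ := hlog _ _ hφ (by linarith)
  have hP0 (w : ℝ) : p + s w ≠ 0 := norm_pos_iff.1 (lt_of_lt_of_le (by positivity) (hP w))
  refine ⟨u, l, Complex.log (p + s 0), hu, hui, hxu, hki, hku, hl, fun w => ?_⟩
  have hexp := exp_intervalIntegral_of_hasDerivAt (P := fun w => p + s w) hu
    (fun x => (hsu x).const_add p) w
  have hF' : 1 + (F w - (p + s w)) * (p + s w)⁻¹ = F w * (p + s w)⁻¹ := by
    have := hP0 w
    field_simp
    ring
  have hF0 : F w ≠ 0 := norm_pos_iff.1 (hδ.trans_le (hFδ w))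
  rw [Complex.exp_add, Complex.exp_add, Complex.exp_log (hP0 0), ← hexp, hll, hF',
    Complex.exp_log (mul_ne_zero hF0 (inv_ne_zero (hP0 w)))]
  field_simp [hP0 w]

lemma levyDensity_sub_apply (d : ℝ → ℂ) (m : ℝ) :
    levyDensity (fun x => d x - ((m * Real.exp (-|x|) / x : ℝ) : ℂ)) m = d := by
  ext x
  have : m * Real.exp (-|x|) / |x| *
      ((Set.Ioi 0).indicator (fun _ => 1) x - (Set.Iio 0).indicator (fun _ => 1) x) =
      m * Real.exp (-|x|) / x := by
    rcases lt_trichotomy x 0 with hx | rfl | hx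
    · rw [Set.indicator_of_notMem (by simp [hx.le]), Set.indicator_of_mem (by simpa using hx),
        abs_of_neg hx, div_neg]
      ring
    -- At the origin both sides vanish, since division by `0` gives `0`.
    · simp
    · rw [Set.indicator_of_mem (by simpa using hx), Set.indicator_of_notMem (by simp [hx.le]),
        abs_of_pos hx]
      ring
  rw [levyDensity, this, sub_add_cancel]

lemma index_eq_of_hasIndex {F : ℝ → ℂ} {m : ℝ} (h : HasIndex F m) : index F = m := by
  have hex : ∃ m, HasIndex F m := ⟨m, h⟩
  rw [index, dif_pos hex]
  exact hex.choose_spec.unique h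

/-- The singular part of the density: near the origin `𝓕⁻ u` differs from its value there, which
is `-2πi m`, by `O(|x|)`, so that subtracting the model density `m e^{-|x|} / x` leaves an
integrable function. -/
lemma integrable_fourierInv_div_sub {u : ℝ → ℂ} {m : ℝ} (hu : Integrable u)
    (hxu : Integrable fun x : ℝ => x * u x) (hk : Integrable (𝓕⁻ u))
    (hm : ∫ t, u t = -2 * Real.pi * Complex.I * m) :
    Integrable fun x : ℝ => 𝓕⁻ u x / (-2 * Real.pi * Complex.I * x) -
      ((m * Real.exp (-|x|) / x : ℝ) : ℂ) := by
  have hE : Integrable fun x : ℝ => ((Real.exp (-|x|) : ℝ) : ℂ) := integrable_exp_neg_abs.ofReal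
  have hc : -2 * Real.pi * Complex.I ≠ 0 := by simp [Real.pi_ne_zero]
  have hψ := integrable_div_of_norm_le_mul_abs
    (ψ := fun x => 𝓕⁻ u x - (-2 * Real.pi * Complex.I * m) * ((Real.exp (-|x|) : ℝ) : ℂ))
    (M := (2 * Real.pi * ∫ t : ℝ, ‖t * u t‖) + ‖-2 * Real.pi * Complex.I * m‖)
    (hk.sub (hE.const_mul _)) fun x => ?_
  · refine (hψ.const_mul (-2 * Real.pi * Complex.I)⁻¹).congr ?_
    filter_upwards [Measure.ae_ne volume (0 : ℝ)] with x hx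
    have : (x : ℂ) ≠ 0 := by exact_mod_cast hx
    push_cast
    field_simp
    ring
  · have h1 := norm_fourierInv_sub_le hu hxu x
    rw [hm] at h1
    have h2 : ‖1 - ((Real.exp (-|x|) : ℝ) : ℂ)‖ ≤ |x| := by
      rw [← Complex.ofReal_one, ← Complex.ofReal_sub, Complex.norm_real, Real.norm_of_nonneg]
      · linarith [Real.add_one_le_exp (-|x|)]
      · simp
    calc _ = ‖(𝓕⁻ u x - -2 * Real.pi * Complex.I * m) +
            (-2 * Real.pi * Complex.I * m) * (1 - ((Real.exp (-|x|) : ℝ) : ℂ))‖ := by ring_nf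
      _ ≤ (2 * Real.pi * ∫ t : ℝ, ‖t * u t‖) * |x| + ‖-2 * Real.pi * Complex.I * m‖ * |x| := by
          refine (norm_add_le _ _).trans (add_le_add h1 ?_)
          rw [norm_mul]
          gcongr
      _ = _ := by ring

/-- The index is read off from the limits of the continuous logarithm
`c + ∫ u + 𝓕 l`, in which `𝓕 l` vanishes at infinity by the Riemann–Lebesgue lemma. The sign comes
from the orientation-reversing substitution `z = -2πw`. -/
lemma exists_hasIndex {F : ℝ → ℂ} {u l : ℝ → ℂ} {c p : ℂ}
    (hu : Continuous u) (hui : Integrable u) (hl : Integrable l)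
    (hF : ∀ w : ℝ, F (-2 * Real.pi * w) =
      Complex.exp (c + (∫ t in (0 : ℝ)..w, u t) + 𝓕 l w))
    (htop : Tendsto F atTop (𝓝 p)) (hbot : Tendsto F atBot (𝓝 p)) :
    ∃ m : ℝ, HasIndex F m ∧ ∫ t, u t = -2 * Real.pi * Complex.I * m := by
  set Φ : ℝ → ℂ := fun w => c + (∫ t in (0 : ℝ)..w, u t) + 𝓕 l w with hΦ
  have hpi := Real.pi_pos
  have hΦc : Continuous Φ := by
    refine (continuous_const.add (intervalIntegral.continuous_primitive
      (fun a b => hu.intervalIntegrable a b) 0)).add ?_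
    exact VectorFourier.fourierIntegral_continuous Real.continuous_fourierChar
      (by exact continuous_inner) hl
  have hRL := Real.zero_at_infty_fourier l
  have hΦtop : Tendsto Φ atTop (𝓝 (c + (∫ t in Set.Ioi (0 : ℝ), u t))) := by
    simpa using (tendsto_const_nhds.add (intervalIntegral_tendsto_integral_Ioi 0
      hui.integrableOn tendsto_id)).add (hRL.mono_left atTop_le_cocompact)
  have hΦbot : Tendsto Φ atBot (𝓝 (c - (∫ t in Set.Iic (0 : ℝ), u t))) := by
    have h := (intervalIntegral_tendsto_integral_Iic 0 hui.integrableOn tendsto_id).neg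
    simp only [← intervalIntegral.integral_symm] at h
    simpa [sub_eq_add_neg] using
      (tendsto_const_nhds.add h).add (hRL.mono_left atBot_le_cocompact)
  have hFz (z : ℝ) : F z = Complex.exp (Φ (z * (-(2 * Real.pi))⁻¹)) := by
    rw [hΦ, ← hF]; congr 1; field_simp
  have hneg : (-(2 * Real.pi))⁻¹ < 0 := inv_lt_zero.2 (by linarith)
  have hzt : Tendsto (fun z : ℝ => z * (-(2 * Real.pi))⁻¹) atTop atBot :=
    tendsto_id.atTop_mul_const_of_neg hneg
  have hzb : Tendsto (fun z : ℝ => z * (-(2 * Real.pi))⁻¹) atBot atTop :=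
    tendsto_id.atBot_mul_const_of_neg hneg
  have ht := hΦbot.comp hzt
  have hb := hΦtop.comp hzb
  have e1 : Complex.exp (c - (∫ t in Set.Iic (0 : ℝ), u t)) = p :=
    tendsto_nhds_unique (ht.cexp) (htop.congr hFz)
  have e2 : Complex.exp (c + (∫ t in Set.Ioi (0 : ℝ), u t)) = p :=
    tendsto_nhds_unique (hb.cexp) (hbot.congr hFz)
  have hsum : (∫ t in Set.Iic (0 : ℝ), u t) + ∫ t in Set.Ioi (0 : ℝ), u t = ∫ t, u t :=
    intervalIntegral.integral_Iic_add_Ioi hui.integrableOn hui.integrableOn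
  obtain ⟨n, hn⟩ := Complex.exp_eq_exp_iff_exists_int.1 (e1.trans e2.symm)
  have hn' : ∫ t, u t = -2 * Real.pi * Complex.I * ((n : ℝ) : ℂ) := by
    rw [← hsum]; push_cast; linear_combination -hn
  refine ⟨n, ⟨fun z => (Φ (z * (-(2 * Real.pi))⁻¹)).im, _, _, ⟨?_, fun z => ?_⟩,
    (Complex.continuous_im.tendsto _).comp ht, (Complex.continuous_im.tendsto _).comp hb, ?_⟩, hn'⟩
  · exact Complex.continuous_im.comp (hΦc.comp (by fun_prop))
  · rw [hFz, Complex.norm_exp, Complex.ofReal_exp, ← Complex.exp_sub]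
    congr 1
    rw [sub_eq_iff_eq_add, add_comm, mul_comm Complex.I, Complex.re_add_im]
  · have him : (c - ∫ t in Set.Iic (0 : ℝ), u t).im - (c + ∫ t in Set.Ioi (0 : ℝ), u t).im =
        n * (2 * Real.pi) := by
      rw [hn]; simp
    rw [him]; field_simp

theorem mainTheorem3 (F : ℝ → ℂ) (hF : F ∈ wienerSpace)
    (hF_ne : NonvanishingOnExtendedReals F) (hF_zero : F 0 = 1) :
    HasIndex F (index F) ∧
    ∃ g : ℝ → ℂ, Integrable g ∧ ∀ z : ℝ,
      Integrable (fun x : ℝ =>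
        (Complex.exp (Complex.I * x * z) - 1) * levyDensity g (index F) x) ∧
      F z = Complex.exp
        (∫ x : ℝ, (Complex.exp (Complex.I * x * z) - 1) * levyDensity g (index F) x) := by
  obtain ⟨p, f, hf, hFf⟩ := hF
  obtain ⟨δ, hδ, hFδ⟩ := hF_ne.exists_pos_le_norm
  -- The substitution `z = -2πw` turns `∫ f(x) e^{ixz} dx` into `𝓕 f w`.
  have hFw (w : ℝ) : F (-2 * Real.pi * w) = p + 𝓕 f w := by
    rw [hFf, fourier_eq_integral_cexp]
    congr 2; ext x
    push_cast
    ring_nf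
  have hzw (z : ℝ) : -2 * Real.pi * (z * (-(2 * Real.pi))⁻¹) = z := by field_simp
  have hneg : (-(2 * Real.pi))⁻¹ < 0 := inv_lt_zero.2 (by linarith [Real.pi_pos])
  have hFz (z : ℝ) : p + 𝓕 f (z * (-(2 * Real.pi))⁻¹) = F z := by rw [← hFw, hzw]
  have hRL := Real.zero_at_infty_fourier f
  have htop : Tendsto F atTop (𝓝 p) := by
    have := ((hRL.mono_left atBot_le_cocompact).comp
      (tendsto_id.atTop_mul_const_of_neg hneg)).const_add p
    rw [add_zero] at this
    exact this.congr hFz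
  have hbot : Tendsto F atBot (𝓝 p) := by
    have := ((hRL.mono_left atTop_le_cocompact).comp
      (tendsto_id.atBot_mul_const_of_neg hneg)).const_add p
    rw [add_zero] at this
    exact this.congr hFz
  obtain ⟨u, l, c, hu, hui, hxu, hki, hku, hl, hexp⟩ :=
    exists_fourier_factorization hf hFw hδ fun w => hFδ _
  obtain ⟨m, hm, hum⟩ := exists_hasIndex hu hui hl hexp htop hbot
  rw [index_eq_of_hasIndex hm]
  set d : ℝ → ℂ := fun x => 𝓕⁻ u x / (-2 * Real.pi * Complex.I * x) + l x with hd
  refine ⟨hm, fun x => d x - ((m * Real.exp (-|x|) / x : ℝ) : ℂ), ?_, fun z => ?_⟩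
  · refine ((integrable_fourierInv_div_sub hui hxu hki hum).add hl).congr (.of_forall fun x => ?_)
    simp only [hd, Pi.add_apply]
    ring
  rw [levyDensity_sub_apply]
  set w := z * (-(2 * Real.pi))⁻¹ with hw
  have hz : z = -2 * Real.pi * w := (hzw z).symm
  obtain ⟨j1, j2⟩ := intervalIntegral_fourier hki w
  have hl1 : Integrable fun x : ℝ => l x * Complex.exp (-2 * Real.pi * Complex.I * x * w) := by
    refine hl.mul_bdd (c := 1) (Continuous.aestronglyMeasurable (by fun_prop))
      (.of_forall fun x => ?_)
    simp [Complex.norm_exp]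
  have hl2 : 𝓕 l w - 𝓕 l 0 =
      ∫ x : ℝ, (l x * Complex.exp (-2 * Real.pi * Complex.I * x * w) - l x) := by
    rw [integral_sub hl1 hl, fourier_eq_integral_cexp, fourier_eq_integral_cexp]
    simp
  have hsplit : (fun x : ℝ => (Complex.exp (Complex.I * x * z) - 1) * d x) = fun x : ℝ =>
      (Complex.exp (-2 * Real.pi * Complex.I * x * w) - 1) *
        (𝓕⁻ u x / (-2 * Real.pi * Complex.I * x)) +
      (l x * Complex.exp (-2 * Real.pi * Complex.I * x * w) - l x) := by
    ext x
    have : Complex.I * x * z = -2 * Real.pi * Complex.I * x * w := by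
      rw [hz]; push_cast; ring
    rw [this]
    simp only [hd]
    ring
  have hl12 : Integrable fun x : ℝ =>
      l x * Complex.exp (-2 * Real.pi * Complex.I * x * w) - l x := hl1.sub hl
  rw [hsplit]
  refine ⟨j1.add hl12, ?_⟩
  rw [integral_add j1 hl12, ← j2, ← hl2]
  have h0 : Complex.exp (c + 𝓕 l 0) = 1 := by
    have := hexp 0
    rw [mul_zero, hF_zero] at this
    simpa using this.symm
  simp only [hku]
  calc F z = Complex.exp (c + (∫ t in (0 : ℝ)..w, u t) + 𝓕 l w) := by rw [hz, hexp]
    _ = Complex.exp ((c + 𝓕 l 0) + ((∫ t in (0 : ℝ)..w, u t) + (𝓕 l w - 𝓕 l 0))) := by ring_nf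
    _ = _ := by rw [Complex.exp_add, h0, one_mul]
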